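/- **Definitions.** A *(multi-head) hyper temporal network* (HyTN) $\mathcal H=(V,\mathcal A)$ consists of a finite node set $V$ and a finite family $\mathcal A$ of hyperarcs $A=(t_A,H_A,w_A)$ with tail $t_A\in V$, non-empty head set $H_A\subseteq V\setminus\{t_A\}$ and weights $w_A:H_A\to\mathbb R$. It is *consistent* if there is $s:V\to\mathbb R$ with $s(t_A)\ge\min_{h\in H_A}(s(h)-w_A(h))$ for all $A\in\mathcal A$; HyTN-consistency asks to decide this. A node is a *sink* if it is the tail of no hyperarc. A *mean payoff game* (MPG) is a finite weighted directed graph without loops or parallel arcs, in which every node has an outgoing arc, with its nodes partitioned into $V_0\sqcup V_1$. From a start node $s$, a pebble is moved along arcs, by Player $p$ at the nodes of $V_p$, until it returns for the first time to an already visited node; the payoff is the average weight of the cycle thus closed. Player 0 wins if the payoff is negative, otherwise Player 1 wins. A node is a *winning start* for Player 1 if Player 1 has a (history-dependent) strategy that wins every play from it. The value $\nu_s$ is the real number such that Player 0 has a strategy ensuring payoff at most $\nu_s$ from $s$ and Player 1 has one ensuring payoff at least $\nu_s$. MPG-Threshold asks, given an MPG and a real $T$, for the set of nodes $s$ with $\nu_s\ge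 T$. For a HyTN $\mathcal H$ without sinks let $G_{\mathcal H}$ be the MPG with $V_0=V$, $V_1=\mathcal A$, and arc set $$\{(t_A,A,0): A\in\mathcal A\}\cup\{(A,h,w_A(h)): A\in\mathcal A,\ h\in H_A\}.$$ For an arbitrary HyTN $\mathcal H$ let $G^+_{\mathcal H}$ be the MPG given by the same construction together with, for every sink $x$, one new node $z_x\in V_1$ and the arcs $(x,z_x,0)$ and $(z_x,x,0)$; thus $G^+_{\mathcal H}=G_{\mathcal H}$ if there are no sinks. Rational-weighted HyTNs and instances $(G,T)$ of MPG-Threshold (with rational weights and rational $T$) are encoded over a finite alphabet as adjacency lists: nodes and hyperarcs have distinct binary words as names; each node of a HyTN is followed by its outgoing hyperarcs, and each hyperarc by its heads with their weights; each node of a game is given with its owner, followed by its outgoing arcs with their weights; numbers are written in binary. All namings and orders of listing are allowed. **Theorem.** There is a log-space, linear-time, local-replacement reduction from HyTN-consistency to MPG-Threshold. Precisely: 1. There are a single deterministic Turing machine with a two-way read-only input tape, a work tape and a write-only output, and a constant $C$, such that for every rational-weighted HyTN $\mathcal H$ and every word $x$ encoding $\mathcal H$, the machine halts on $x$ after at most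 $C(|x|+1)$ steps, uses at most $C\lfloor\log_2(|x|+2)\rfloor$ work tape cells, and outputs an encoding of the MPG-Threshold instance $(G^+_{\mathcal H},0)$, which is an encoding of $(G_{\mathcal H},0)$ if $\mathcal H$ has no sinks. 2. For every (real-weighted) HyTN $\mathcal H$ without sinks, $G_{\mathcal H}$ arises by local replacement: the nodes of $V$ belong to Player 0, each hyperarc $A$ gives one node of Player 1, and the arc set is the union over $A\in\mathcal A$ of the claws $\{(t_A,A,0)\}\cup\{(A,h,w_A(h)):h\in H_A\}$. Moreover, $\mathcal H$ is consistent if and only if every node of $G_{\mathcal H}$ is a winning start for Player 1, and if and only if the answer to MPG-Threshold on $(G_{\mathcal H},0)$ is the set of all nodes. 3. For every (real-weighted) HyTN $\mathcal H$, the same holds for $G^+_{\mathcal H}$, where each sink $x$ is in addition treated like a hyperarc $(x,\{x\},0)$. -/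

import Mathlib

universe u v

/-! ## Hyper temporal networks (multi-head) -/

/-- A family of weighted multi-head hyperarcs `A = (t_A, H_A, w_A)` on the node set `V`,
indexed by `ι`. Only the values `weight A h` with `h ∈ heads A` are meaningful. -/
structure HyperarcFamily (V : Type u) (ι : Type v) where
  tail : ι → V
  heads : ι → Finset V
  weight : ι → V → ℝ
  heads_nonempty : ∀ A, (heads A).Nonempty

/-- A (multi-head, real-weighted) hyper temporal network with node set `V` and with hyperarc set
(indexed by) `ι`: the tail of a hyperarc is never one of its heads. -/
structure HyTN (V : Type u) (ι : Type v) extends HyperarcFamily V ι where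
  tail_notMem : ∀ A, tail A ∉ heads A

namespace HyTN

variable {V : Type u} {ι : Type v}

/-- `s` is a feasible scheduling: `s(t_A) ≥ min_{h ∈ H_A} (s(h) - w_A(h))` for all hyperarcs. -/
def Feasible (H : HyTN V ι) (s : V → ℝ) : Prop :=
  ∀ A, (H.heads A).inf' (H.heads_nonempty A) (fun h => s h - H.weight A h) ≤ s (H.tail A)

/-- The yes-instances of HyTN-consistency. -/
def Consistent (H : HyTN V ι) : Prop := ∃ s : V → ℝ, H.Feasible s

/-- A sink: a node that is the tail of no hyperarc. -/
def IsSink (H : HyTN V ι) (x : V) : Prop := ∀ A, H.tail A ≠ x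

/-- Every node is the tail of some hyperarc. -/
def SinkFree (H : HyTN V ι) : Prop := ∀ x, ∃ A, H.tail A = x

end HyTN

/-! ## Mean payoff games -/

inductive Player
  | zero
  | one

/-- A mean payoff game with node set `N = V₀ ⊔ V₁`, where `V_p` is the set of nodes owned by
Player `p`. There are no loops and no parallel arcs, and every node has an outgoing arc.
Only the values `weight a b` with `Adj a b` are meaningful. -/
structure MPG (N : Type u) where
  owner : N → Player
  Adj : N → N → Prop
  weight : N → N → ℝ
  loopless : ∀ a, ¬ Adj a a
  exists_out : ∀ a, ∃ b, Adj a b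

/-- Weighted arcs `(tail, head, weight)`. -/
abbrev WArc (N : Type u) : Type u := N × N × ℝ

namespace MPG

variable {N : Type u}

/-- The set of weighted arcs of the game. -/
def arcs (G : MPG N) : Set (WArc N) := {e | G.Adj e.1 e.2.1 ∧ e.2.2 = G.weight e.1 e.2.1}

/-- A strategy of Player `p`: from the list of the previously visited nodes and the current node
it returns the node to be visited next; at the nodes of Player `p` the move must be legal. -/
structure Strategy (G : MPG N) (p : Player) where
  move : List N → N → N
  legal : ∀ (past : List N) (a : N), G.owner a = p → G.Adj a (move past a)

/-- `ρ 0, …, ρ j` is a complete play from `s`: it ends at time `j`, when for the first time the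
pebble comes back to an already visited node, the node `ρ i`. -/
structure IsPlay (G : MPG N) (s : N) (ρ : ℕ → N) (i j : ℕ) : Prop where
  start : ρ 0 = s
  adj : ∀ t < j, G.Adj (ρ t) (ρ (t + 1))
  lt : i < j
  closes : ρ i = ρ j
  fresh : ∀ a b, a < b → b < j → ρ a ≠ ρ b

/-- Up to time `j`, Player `p` has moved along `ρ` as prescribed by `σ`. -/
def Strategy.Follows {G : MPG N} {p : Player} (σ : G.Strategy p) (ρ : ℕ → N) (j : ℕ) : Prop :=
  ∀ t < j, G.owner (ρ t) = p → ρ (t + 1) = σ.move ((List.range t).map ρ) (ρ t)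

/-- The amount that Player 0 pays to Player 1: the average weight of the cycle closed. -/
noncomputable def payoff (G : MPG N) (ρ : ℕ → N) (i j : ℕ) : ℝ :=
  (∑ t ∈ Finset.Ico i j, G.weight (ρ t) (ρ (t + 1))) / ((j : ℝ) - (i : ℝ))

/-- Player 0 wins if the payoff is negative, otherwise Player 1 wins. -/
def Wins (G : MPG N) (ρ : ℕ → N) (i j : ℕ) : Player → Prop
  | .zero => G.payoff ρ i j < 0
  | .one => ¬ G.payoff ρ i j < 0

/-- `s` is a winning start position for Player `p`. -/
def WinningStart (G : MPG N) (p : Player) (s : N) : Prop :=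
  ∃ σ : G.Strategy p, ∀ ρ i j, G.IsPlay s ρ i j → σ.Follows ρ j → G.Wins ρ i j p

/-- `r` is the value of the game started at `s`: Player 0 has a strategy ensuring payoff at most
`r`, and Player 1 has a strategy ensuring payoff at least `r`. -/
def IsValue (G : MPG N) (s : N) (r : ℝ) : Prop :=
  (∃ σ : G.Strategy .zero, ∀ ρ i j, G.IsPlay s ρ i j → σ.Follows ρ j → G.payoff ρ i j ≤ r) ∧
  (∃ σ : G.Strategy .one, ∀ ρ i j, G.IsPlay s ρ i j → σ.Follows ρ j → r ≤ G.payoff ρ i j)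

/-- The answer to MPG-Threshold(`T`): the nodes `s` whose value is at least `T`. -/
def thresholdSet (G : MPG N) (T : ℝ) : Set N := {s | ∃ r, G.IsValue s r ∧ T ≤ r}

end MPG

/-! ## The game of a network -/

/-- The game on `V₀ = V` and `V₁ = ι` whose arcs are `(t_A, A, 0)` for each `A`, and
`(A, h, w_A(h))` for each `A` and each `h ∈ H_A`. -/
def HyperarcFamily.clawGame {V : Type u} {ι : Type v} (F : HyperarcFamily V ι)
    (hF : ∀ x, ∃ A, F.tail A = x) : MPG (V ⊕ ι) where
  owner
    | .inl _ => .zero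
    | .inr _ => .one
  Adj
    | .inl x, .inr A => F.tail A = x
    | .inr A, .inl h => h ∈ F.heads A
    | .inl _, .inl _ => False
    | .inr _, .inr _ => False
  weight
    | .inr A, .inl h => F.weight A h
    | _, _ => 0
  loopless := by
    rintro (a | a) h <;> exact h
  exists_out := by
    rintro (a | a)
    · obtain ⟨A, hA⟩ := hF a
      exact ⟨.inr A, hA⟩
    · obtain ⟨h, hh⟩ := F.heads_nonempty a
      exact ⟨.inl h, hh⟩

/-- The claw that replaces one hyperarc `(t, S, w)`; `()` stands for its single new node. -/
def claw {V : Type u} (t : V) (S : Finset V) (w : V → ℝ) : Set (WArc (V ⊕ Unit)) :=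
  {(.inl t, .inr (), 0)} ∪ {e | ∃ h ∈ S, e = (.inr (), .inl h, w h)}

/-- `G` arises from `F` by local replacement with the given gadget: the old nodes belong to
Player 0, each hyperarc contributes one new node, which belongs to Player 1, and the arcs of `G` are
the union, over the hyperarcs `A`, of the copies of the gadget of `A`, which is determined by `A`
alone. -/
def MPG.IsLocalReplacement {V : Type u} {ι : Type v} (G : MPG (V ⊕ ι)) (F : HyperarcFamily V ι)
    (gadget : V → Finset V → (V → ℝ) → Set (WArc (V ⊕ Unit))) : Prop :=
  (∀ x, G.owner (.inl x) = .zero) ∧ (∀ A, G.owner (.inr A) = .one) ∧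
  G.arcs = ⋃ A : ι,
    (fun e : WArc (V ⊕ Unit) =>
      ((Sum.map id (fun _ => A) e.1, Sum.map id (fun _ => A) e.2.1, e.2.2) : WArc (V ⊕ ι))) ''
      gadget (F.tail A) (F.heads A) (F.weight A)

namespace HyTN

variable {V : Type u} {ι : Type v}

/-- The game `G_H` of a sink-free network. -/
def game (H : HyTN V ι) (hH : H.SinkFree) : MPG (V ⊕ ι) := H.toHyperarcFamily.clawGame hH

/-- The hyperarcs of `H`, and for each sink `x` the trivially satisfied one `(x, {x}, 0)`. For a
sink-free `H` nothing is added. -/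
def closure (H : HyTN V ι) : HyperarcFamily V (ι ⊕ {x : V // H.IsSink x}) where
  tail := Sum.elim H.tail (fun x => x.1)
  heads := Sum.elim H.heads (fun x => {x.1})
  weight := Sum.elim H.weight (fun _ _ => 0)
  heads_nonempty := by
    rintro (A | x)
    · exact H.heads_nonempty A
    · exact Finset.singleton_nonempty x.1

theorem closure_tail (H : HyTN V ι) (x : V) : ∃ A, H.closure.tail A = x := by
  by_cases hx : H.IsSink x
  · exact ⟨.inr ⟨x, hx⟩, rfl⟩
  · unfold IsSink at hx
    push Not at hx
    obtain ⟨A, hA⟩ := hx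
    exact ⟨.inl A, hA⟩

/-- The game of an arbitrary network: the arcs of `G_H`, and for each sink `x` a new node of
Player 1 joined to `x` by the two arcs of weight `0`. -/
def closedGame (H : HyTN V ι) : MPG (V ⊕ (ι ⊕ {x : V // H.IsSink x})) :=
  H.closure.clawGame H.closure_tail

end HyTN

/-! ## Encodings: adjacency lists, with binary names and binary rational weights -/

/-- The finite alphabet of the encodings. -/
inductive Letter
  | bit (b : Bool)
  | neg
  | slash
  | node
  | hyper
  | head
  | weight
  | threshold
  | black
  | white
  | arc

/-- A binary word. -/
def bitsCode (l : List Bool) : List Letter := l.map Letter.bit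

/-- The rational number `q`: sign, numerator in binary, slash, denominator in binary. -/
def ratCode (q : ℚ) : List Letter :=
  (if q < 0 then [Letter.neg] else []) ++ bitsCode (Computability.encodeNat q.num.natAbs) ++
    [Letter.slash] ++ bitsCode (Computability.encodeNat q.den)

/-- The choices made in writing down a network: names of the nodes and of the hyperarcs, orders in
which they are listed, and the weights as rational numbers. -/
structure HyTN.Presentation {V : Type u} {ι : Type v} (H : HyTN V ι) where
  nodeName : V → List Bool
  nodeName_injective : Function.Injective nodeName
  hyperName : ι → List Bool
  hyperName_injective : Function.Injective hyperName
  nodes : List V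
  nodes_nodup : nodes.Nodup
  mem_nodes : ∀ x, x ∈ nodes
  out : V → List ι
  out_nodup : ∀ x, (out x).Nodup
  mem_out : ∀ x A, A ∈ out x ↔ H.tail A = x
  headList : ι → List V
  headList_nodup : ∀ A, (headList A).Nodup
  mem_headList : ∀ A h, h ∈ headList A ↔ h ∈ H.heads A
  rat : ι → V → ℚ
  rat_eq : ∀ A, ∀ h ∈ H.heads A, (rat A h : ℝ) = H.weight A h

/-- Each node is followed by the list of its outgoing hyperarcs, and each hyperarc by the list of
its heads with their weights. -/
def HyTN.Presentation.code {V : Type u} {ι : Type v} {H : HyTN V ι} (P : H.Presentation) :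
    List Letter :=
  P.nodes.flatMap fun x =>
    Letter.node :: bitsCode (P.nodeName x) ++
      (P.out x).flatMap fun A =>
        Letter.hyper :: bitsCode (P.hyperName A) ++
          (P.headList A).flatMap fun h =>
            Letter.head :: bitsCode (P.nodeName h) ++ Letter.weight :: ratCode (P.rat A h)

/-- The word `x` encodes the (rational-weighted) network `H`. -/
def HyTN.IsCode {V : Type u} {ι : Type v} (H : HyTN V ι) (x : List Letter) : Prop :=
  ∃ P : H.Presentation, P.code = x

/-- The choices made in writing down a game. -/
structure MPG.Presentation {N : Type u} (G : MPG N) where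
  name : N → List Bool
  name_injective : Function.Injective name
  nodes : List N
  nodes_nodup : nodes.Nodup
  mem_nodes : ∀ a, a ∈ nodes
  out : N → List N
  out_nodup : ∀ a, (out a).Nodup
  mem_out : ∀ a b, b ∈ out a ↔ G.Adj a b
  rat : N → N → ℚ
  rat_eq : ∀ a b, G.Adj a b → (rat a b : ℝ) = G.weight a b

/-- The colour of a node: black for Player 0 and white for Player 1. -/
def Player.colour : Player → Letter
  | .zero => Letter.black
  | .one => Letter.white

/-- The threshold, and then each node, with its colour, followed by the list of its outgoing
arcs with their weights. -/
def MPG.Presentation.code {N : Type u} {G : MPG N} (P : G.Presentation) (T : ℚ) : List Letter :=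
  Letter.threshold :: ratCode T ++
    P.nodes.flatMap fun a =>
      (G.owner a).colour :: bitsCode (P.name a) ++
        (P.out a).flatMap fun b =>
          Letter.arc :: bitsCode (P.name b) ++ Letter.weight :: ratCode (P.rat a b)

/-- The word `y` encodes the instance `(G, T)` of MPG-Threshold. -/
def MPG.IsCode {N : Type u} (G : MPG N) (T : ℚ) (y : List Letter) : Prop :=
  ∃ P : G.Presentation, P.code T = y

/-! ## Turing machines with a read-only input, a work tape and a write-only output -/

/-- What the input head sees: an input symbol or one of the two end markers. -/
inductive InSym (α : Type)
  | left
  | sym (a : α)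
  | right

inductive HeadMove
  | left
  | stay
  | right

/-- A deterministic machine. On a state, the input symbol and the work symbol read, `step` is
`none` (halt) or gives the new state, the move of the input head, the work symbol written, the move
of the work head, and the word appended to the output. As `step` has a finite domain, at most a
constant number of output symbols is written per step. -/
structure Transducer (α β : Type) where
  Q : Type
  Γ : Type
  finite_Q : Finite Q
  finite_Γ : Finite Γ
  blank : Γ
  start : Q
  step : Q → InSym α → Γ → Option (Q × HeadMove × Γ × HeadMove × List β)

namespace Transducer

variable {α β : Type}

/-- Configurations. The input `x` is in the cells `1, …, |x|` of the input tape, between end markers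
in the cells `0` and `|x| + 1`. The work tape has the cells `0, 1, 2, …`. -/
structure Cfg (M : Transducer α β) where
  state : M.Q
  inPos : ℕ
  work : ℕ → M.Γ
  workPos : ℕ
  out : List β

/-- The content of the cell `k` of the input tape. -/
def readIn (x : List α) : ℕ → InSym α
  | 0 => .left
  | k + 1 => match x[k]? with
    | some a => .sym a
    | none => .right

/-- Moving a head that is never to leave the cells `0, …, b`. -/
def moveIn (b : ℕ) : HeadMove → ℕ → ℕ
  | .left, k => k - 1
  | .stay, k => k
  | .right, k => min (k + 1) b

/-- Moving a head on a tape with the cells `0, 1, 2, …`. -/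
def moveWork : HeadMove → ℕ → ℕ
  | .left, k => k - 1
  | .stay, k => k
  | .right, k => k + 1

def init (M : Transducer α β) : M.Cfg where
  state := M.start
  inPos := 0
  work := fun _ => M.blank
  workPos := 0
  out := []

/-- One step on the input `x`; `none` if the machine halts. -/
def next (M : Transducer α β) (x : List α) (c : M.Cfg) : Option M.Cfg :=
  (M.step c.state (readIn x c.inPos) (c.work c.workPos)).map fun r =>
    { state := r.1
      inPos := moveIn (x.length + 1) r.2.1 c.inPos
      work := Function.update c.work c.workPos r.2.2.1
      workPos := moveWork r.2.2.2.1 c.workPos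
      out := c.out ++ r.2.2.2.2 }

/-- The configuration after `t` steps on the input `x`, if the machine has not halted before. -/
def run (M : Transducer α β) (x : List α) : ℕ → Option M.Cfg
  | 0 => some M.init
  | t + 1 => (M.run x t).bind (M.next x)

/-- On the input `x`, the machine halts with output `y` after at most `C (|x| + 1)` steps, and its
work head visits only the first `C log₂ (|x| + 2)` cells of the work tape (logarithm rounded
down). -/
def ComputesWithin (M : Transducer α β) (C : ℕ) (x : List α) (y : List β) : Prop :=
  ∃ t ≤ C * (x.length + 1), ∃ c : M.Cfg,
    M.run x t = some c ∧ M.next x c = none ∧ c.out = y ∧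
    ∀ k ≤ t, ∀ d : M.Cfg, M.run x k = some d → d.workPos < C * Nat.log 2 (x.length + 2)

end Transducer

/-! Correctness rests on potentials. Player 1 wins a finite game from every node exactly if some `p`
satisfies `p b ≤ p a + w(a, b)` for every arc out of a Player 0 node and for at least one arc out of
every Player 1 node. In the game of a network, these inequalities at a hyperarc node `A` squeeze `p
A` between `min (s h - w_A h)` and `s (t_A)`, so potentials are feasible schedulings extended to the
hyperarc nodes (`exists_isPotential_clawGame_iff`).

A potential makes a positional strategy win, since cycle weights dominate a telescoping sum.
Conversely (`exists_isPotential`), let `p x` be the infimum of the weights of simple paths ending in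
`x`, from any start, on which Player 1 obeys a winning strategy for that start. Appending an arc
gives another simple path or closes a cycle; the cycle has nonnegative weight because the strategy
wins, so deleting it does not increase the weight. This works for history-dependent strategies and
needs no positional determinacy.

MPG-Threshold speaks of values, whose existence comes from backward induction over histories
(`isValue_historyValue`); value at least 0 then means that Player 1 wins.

The machine needs no work tape. The arcs out of Player 0 nodes and the hyperarc nodes are written in
two traversals of the input, and the only names needed repeatedly, those of sinks, are reread on the
spot, so the time stays linear. The prefixes `0`, `10`, `11` keep the names of old nodes, hyperarcs
and new sink partners apart. -/

namespace MPG

/-! ### Potentials and games that Player 1 wins everywhere -/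

variable {N : Type u}

/-- `p` certifies that all nodes are winning for Player 1: no arc out of a node of Player 0, and
some arc out of every node of Player 1 does not, increase `p` by more than its weight. -/
structure IsPotential (G : MPG N) (p : N → ℝ) : Prop where
  zero : ∀ a b, G.owner a = .zero → G.Adj a b → p b ≤ p a + G.weight a b
  one : ∀ a, G.owner a = .one → ∃ b, G.Adj a b ∧ p b ≤ p a + G.weight a b

theorem payoff_congr (G : MPG N) {ρ ρ' : ℕ → N} {i j : ℕ}
    (h : ∀ t, i ≤ t → t ≤ j → ρ t = ρ' t) : G.payoff ρ i j = G.payoff ρ' i j := by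
  unfold payoff
  congr 1
  refine Finset.sum_congr rfl fun t ht => ?_
  rw [Finset.mem_Ico] at ht
  rw [h t ht.1 ht.2.le, h (t + 1) (by omega) (by omega)]

theorem payoff_nonneg_iff (G : MPG N) {ρ : ℕ → N} {i j : ℕ} (hij : i < j) :
    0 ≤ G.payoff ρ i j ↔ 0 ≤ ∑ t ∈ Finset.Ico i j, G.weight (ρ t) (ρ (t + 1)) := by
  have : (0 : ℝ) < (j : ℝ) - i := sub_pos.2 (by exact_mod_cast hij)
  unfold payoff
  rw [le_div_iff₀ this, zero_mul]

/-- Player 1 always takes an arc that respects the potential. Then every arc of the closed cycle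
weighs at least the increase of `p` along it, and these increases sum to zero. -/
theorem IsPotential.winningStart {G : MPG N} {p : N → ℝ} (hp : G.IsPotential p) (s : N) :
    G.WinningStart .one s := by
  classical
  have key : ∀ a, ∃ b, G.Adj a b ∧ (G.owner a = .one → p b ≤ p a + G.weight a b) := by
    intro a
    by_cases ha : G.owner a = .one
    · obtain ⟨b, hb, h⟩ := hp.one a ha
      exact ⟨b, hb, fun _ => h⟩
    · obtain ⟨b, hb⟩ := G.exists_out a
      exact ⟨b, hb, fun h => absurd h ha⟩
  choose f hadj hf using key
  refine ⟨⟨fun _ a => f a, fun _ a _ => hadj a⟩, fun ρ i j hρ hσ => ?_⟩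
  change ¬ G.payoff ρ i j < 0
  rw [not_lt, payoff_nonneg_iff G hρ.lt]
  have hle : ∀ t ∈ Finset.Ico i j, p (ρ (t + 1)) - p (ρ t) ≤ G.weight (ρ t) (ρ (t + 1)) := by
    intro t ht
    have htj := (Finset.mem_Ico.1 ht).2
    rw [sub_le_iff_le_add']
    cases ho : G.owner (ρ t) with
    | zero => exact hp.zero _ _ ho (hρ.adj t htj)
    | one =>
      have h1 : ρ (t + 1) = f (ρ t) := hσ t htj ho
      rw [h1]
      exact hf _ ho
  refine le_trans (le_of_eq ?_) (Finset.sum_le_sum hle)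
  rw [Finset.sum_Ico_eq_sub _ hρ.lt.le, Finset.sum_range_sub (fun t => p (ρ t)),
    Finset.sum_range_sub (fun t => p (ρ t)), hρ.closes]
  ring

/-- `ρ 0, …, ρ k` is a simple path on which Player 1 has followed the strategy chosen for its
start node. -/
structure IsSimplePath (G : MPG N) (σ : N → G.Strategy .one) (ρ : ℕ → N) (k : ℕ) : Prop where
  adj : ∀ t < k, G.Adj (ρ t) (ρ (t + 1))
  fresh : ∀ a b, a < b → b ≤ k → ρ a ≠ ρ b
  follows : (σ (ρ 0)).Follows ρ k

/-- The weight of the path `ρ 0, …, ρ k`. -/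
noncomputable def pathWeight (G : MPG N) (ρ : ℕ → N) (k : ℕ) : ℝ :=
  ∑ t ∈ Finset.range k, G.weight (ρ t) (ρ (t + 1))

/-- The weights of the simple paths to `x`. -/
def simpleWeights (G : MPG N) (σ : N → G.Strategy .one) (x : N) : Set ℝ :=
  {r | ∃ ρ k, G.IsSimplePath σ ρ k ∧ ρ k = x ∧ G.pathWeight ρ k = r}

theorem simpleWeights_nonempty (G : MPG N) (σ : N → G.Strategy .one) (x : N) :
    (G.simpleWeights σ x).Nonempty :=
  ⟨_, fun _ => x, 0, ⟨fun t ht => absurd ht (Nat.not_lt_zero t), fun a b h h' => by omega,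
    fun t ht => absurd ht (Nat.not_lt_zero t)⟩, rfl, rfl⟩

/-- A simple path has at most as many arcs as there are nodes. Boundedness makes the infimum used as
potential a genuine one. -/
theorem simpleWeights_bddBelow [Finite N] (G : MPG N) (σ : N → G.Strategy .one) (x : N) :
    BddBelow (G.simpleWeights σ x) := by
  classical
  cases nonempty_fintype N
  set W : ℝ := ∑ a : N, ∑ b : N, |G.weight a b|
  have hW : ∀ a b, |G.weight a b| ≤ W := fun a b =>
    (Finset.single_le_sum (f := fun b => |G.weight a b|) (fun _ _ => abs_nonneg _)
      (Finset.mem_univ b)).trans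
    (Finset.single_le_sum (f := fun a => ∑ b : N, |G.weight a b|)
      (fun _ _ => Finset.sum_nonneg fun _ _ => abs_nonneg _) (Finset.mem_univ a))
  have hW0 : 0 ≤ W := Finset.sum_nonneg fun _ _ => Finset.sum_nonneg fun _ _ => abs_nonneg _
  refine ⟨-(Fintype.card N * W), ?_⟩
  rintro r ⟨ρ, k, hρ, -, rfl⟩
  have hk : k ≤ Fintype.card N := by
    have hinj : Function.Injective (fun t : Fin k => ρ t) := by
      intro a b hab
      by_contra hne
      rcases lt_or_gt_of_ne hne with h | h
      · exact hρ.fresh a b h b.2.le hab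
      · exact hρ.fresh b a h a.2.le hab.symm
    simpa using Fintype.card_le_of_injective _ hinj
  have h1 : |G.pathWeight ρ k| ≤ ∑ _t ∈ Finset.range k, W :=
    (Finset.abs_sum_le_sum_abs _ _).trans (Finset.sum_le_sum fun t _ => hW _ _)
  rw [Finset.sum_const, Finset.card_range, nsmul_eq_mul] at h1
  have h2 : (k : ℝ) * W ≤ Fintype.card N * W := by
    gcongr
  linarith [neg_abs_le (G.pathWeight ρ k)]

theorem pathWeight_congr (G : MPG N) {ρ ρ' : ℕ → N} {k : ℕ} (h : ∀ t ≤ k, ρ t = ρ' t) :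
    G.pathWeight ρ k = G.pathWeight ρ' k := by
  refine Finset.sum_congr rfl fun t ht => ?_
  rw [Finset.mem_range] at ht
  rw [h t ht.le, h (t + 1) ht]

theorem map_range_congr {ρ ρ' : ℕ → N} {k : ℕ} (h : ∀ t < k, ρ t = ρ' t) :
    (List.range k).map ρ = (List.range k).map ρ' :=
  List.map_congr_left fun t ht => h t (List.mem_range.1 ht)

/-- Moving on from the end of a simple path; a cycle that is closed has weight at least `0` and is
cut off. -/
theorem IsSimplePath.exists_le {G : MPG N} {σ : N → G.Strategy .one}
    (hσ : ∀ s ρ i j, G.IsPlay s ρ i j → (σ s).Follows ρ j → G.Wins ρ i j .one)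
    {ρ : ℕ → N} {k : ℕ} (hρ : G.IsSimplePath σ ρ k) {v : N} (hv : G.Adj (ρ k) v)
    (hmove : G.owner (ρ k) = .one → v = (σ (ρ 0)).move ((List.range k).map ρ) (ρ k)) :
    ∃ r ∈ G.simpleWeights σ v, r ≤ G.pathWeight ρ k + G.weight (ρ k) v := by
  classical
  set ρ' : ℕ → N := Function.update ρ (k + 1) v with hρ'
  have hlast : ρ' (k + 1) = v := by simp [hρ']
  have hold : ∀ t ≤ k, ρ' t = ρ t := fun t ht => by
    rw [hρ', Function.update_of_ne (by omega)]
  have hadj : ∀ t < k + 1, G.Adj (ρ' t) (ρ' (t + 1)) := by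
    intro t ht
    rcases Nat.lt_succ_iff_lt_or_eq.1 ht with h | rfl
    · rw [hold t h.le, hold (t + 1) h]
      exact hρ.adj t h
    · rw [hlast, hold t le_rfl]
      exact hv
  have hfol : (σ (ρ 0)).Follows ρ' (k + 1) := by
    intro t ht
    rw [map_range_congr (fun u hu => hold u (by omega)), hold t (by omega)]
    rcases Nat.lt_succ_iff_lt_or_eq.1 ht with h | rfl
    · rw [hold (t + 1) h]
      exact hρ.follows t h
    · rw [hlast]
      exact hmove
  have hsum : G.pathWeight ρ' (k + 1) = G.pathWeight ρ k + G.weight (ρ k) v := by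
    rw [← G.pathWeight_congr hold, pathWeight, Finset.sum_range_succ, hlast, hold k le_rfl]
    rfl
  by_cases hfresh : ∃ i ≤ k, ρ i = v
  · obtain ⟨i, hik, hi⟩ := hfresh
    have hplay : G.IsPlay (ρ 0) ρ' i (k + 1) :=
      ⟨hold 0 (Nat.zero_le k), hadj, by omega, by rw [hlast, hold i hik, hi], fun a b hab hb => by
        rw [hold a (by omega), hold b (by omega)]
        exact hρ.fresh a b hab (by omega)⟩
    have hwin : ¬ G.payoff ρ' i (k + 1) < 0 := hσ _ _ _ _ hplay hfol
    rw [not_lt, G.payoff_nonneg_iff hplay.lt, Finset.sum_Ico_eq_sub _ hplay.lt.le] at hwin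
    -- After the cycle is cut off, the initial segment up to `i` remains. It has the same start, so
    -- Player 1 still follows the same strategy on it.
    refine ⟨G.pathWeight ρ i, ⟨ρ, i, ⟨fun t ht => hρ.adj t (by omega),
      fun a b hab hb => hρ.fresh a b hab (by omega), fun t ht => hρ.follows t (by omega)⟩,
      hi, rfl⟩, ?_⟩
    rw [← hsum, ← G.pathWeight_congr fun t ht => hold t (ht.trans hik)]
    exact sub_nonneg.1 hwin
  · refine ⟨_, ⟨ρ', k + 1, ⟨hadj, fun a b hab hb => ?_, ?_⟩, hlast, rfl⟩, hsum.le⟩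
    · rcases Nat.le_succ_iff.1 hb with h | rfl
      · rw [hold a (by omega), hold b h]
        exact hρ.fresh a b hab h
      · rw [hlast, hold a (by omega)]
        exact fun h => hfresh ⟨a, by omega, h⟩
    · rw [hold 0 (Nat.zero_le k)]
      exact hfol

theorem exists_isPotential [Finite N] {G : MPG N} (h : ∀ a, G.WinningStart .one a) :
    ∃ p, G.IsPotential p := by
  choose σ hσ using h
  have hle : ∀ {x r}, r ∈ G.simpleWeights σ x → sInf (G.simpleWeights σ x) ≤ r :=
    fun hr => csInf_le (G.simpleWeights_bddBelow σ _) hr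
  refine ⟨fun x => sInf (G.simpleWeights σ x), fun a b ha hab => ?_, fun a ha => ?_⟩
  · rw [← sub_le_iff_le_add]
    refine le_csInf (G.simpleWeights_nonempty σ a) ?_
    rintro _ ⟨ρ, k, hρ, rfl, rfl⟩
    obtain ⟨r, hr, hr'⟩ := hρ.exists_le hσ hab (fun h => by rw [ha] at h; cases h)
    linarith [hle hr]
  -- The move prescribed at `a` depends on the path that led there, but the potential needs one
  -- successor for all paths. A minimizer of `p b - w(a, b)` is at least as good as each prescribed
  -- move.
  · obtain ⟨b₀, hb₀, hmin⟩ := Set.exists_min_image {b | G.Adj a b}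
      (fun b => sInf (G.simpleWeights σ b) - G.weight a b) (Set.toFinite _) (G.exists_out a)
    refine ⟨b₀, hb₀, ?_⟩
    rw [← sub_le_iff_le_add]
    refine le_csInf (G.simpleWeights_nonempty σ a) ?_
    rintro _ ⟨ρ, k, hρ, rfl, rfl⟩
    have hleg := (σ (ρ 0)).legal ((List.range k).map ρ) (ρ k) ha
    obtain ⟨r, hr, hr'⟩ := hρ.exists_le hσ hleg (fun _ => rfl)
    have := hmin _ hleg
    linarith [hle hr]

theorem forall_winningStart_one_iff [Finite N] {G : MPG N} :
    (∀ a, G.WinningStart .one a) ↔ ∃ p, G.IsPotential p :=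
  ⟨exists_isPotential, fun ⟨_, hp⟩ => hp.winningStart⟩

end MPG

/-! ### Existence of values by backward induction on histories -/

namespace MPG

variable {N : Type u}

/-- Two strategies determine an infinite walk, which repeats a node by finiteness; the first
repetition ends the play. -/
theorem exists_isPlay [Finite N] {G : MPG N} (s : N) (σ : G.Strategy .zero) (τ : G.Strategy .one) :
    ∃ ρ i j, G.IsPlay s ρ i j ∧ σ.Follows ρ j ∧ τ.Follows ρ j := by
  classical
  let next : List N → N → N := fun l a => match G.owner a with
    | .zero => σ.move l a
    | .one => τ.move l a
  -- The past is carried along, because the strategies depend on it.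
  let conf : ℕ → List N × N := fun t => t.rec ([], s) fun _ c => (c.1 ++ [c.2], next c.1 c.2)
  let ρ : ℕ → N := fun t => (conf t).2
  have hist : ∀ t, (conf t).1 = (List.range t).map ρ := by
    intro t
    induction t with
    | zero => rfl
    | succ t ih =>
      rw [List.range_succ, List.map_append, ← ih]
      rfl
  have step : ∀ t, ρ (t + 1) = next ((List.range t).map ρ) (ρ t) := fun t => by
    rw [← hist]
  have hrep : ∃ j, ∃ i < j, ρ i = ρ j := by
    obtain ⟨a, b, hab, hne⟩ := Function.not_injective_iff.1 (not_injective_infinite_finite ρ)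
    rcases lt_or_gt_of_ne hne with h | h
    · exact ⟨b, a, h, hab⟩
    · exact ⟨a, b, h, hab.symm⟩
  obtain ⟨i, hi, hij⟩ := Nat.find_spec hrep
  refine ⟨ρ, i, Nat.find hrep, ⟨rfl, fun t _ => ?_, hi, hij, fun a b hab hb he =>
    Nat.find_min hrep hb ⟨a, hab, he⟩⟩, fun t _ ho => ?_, fun t _ ho => ?_⟩
  · rw [step]
    cases ho : G.owner (ρ t) with
    | zero =>
      simp only [next, ho]
      exact σ.legal _ _ ho
    | one =>
      simp only [next, ho]
      exact τ.legal _ _ ho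
  · rw [step]
    simp only [next, ho]
  · rw [step]
    simp only [next, ho]

section Determinacy

open Classical in
/-- The payoff after a move from the history `l` to `b`, if the cycle is closed by that move, and
the value `f l b` otherwise. -/
noncomputable def moveValue (G : MPG N) (f : List N → N → ℝ) (l : List N) (b : N) : ℝ :=
  if b ∈ l then G.payoff (fun t => (l ++ [b]).getD t b) (l.idxOf b) l.length else f l b

/-- Backward induction for `n` moves from the node `a` that was reached with the past `l`. -/
noncomputable def backward (G : MPG N) : ℕ → List N → N → ℝ
  | 0, _, _ => 0
  | n + 1, l, a => match G.owner a with
    | .zero => sInf (G.moveValue (G.backward n) (l ++ [a]) '' {b | G.Adj a b})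
    | .one => sSup (G.moveValue (G.backward n) (l ++ [a]) '' {b | G.Adj a b})

/-- The value of the game continued at the node `a` that was reached with the past `l`. -/
noncomputable def historyValue (G : MPG N) (l : List N) (a : N) : ℝ :=
  G.backward (Nat.card N - l.length) l a

theorem moveValue_backward (G : MPG N) {n : ℕ} {l : List N} (h : l.length + n = Nat.card N) :
    G.moveValue (G.backward n) l = G.moveValue G.historyValue l := by
  funext b
  have : Nat.card N - l.length = n := by omega
  simp only [moveValue, historyValue, this]

/-- The optimality equation. The budget of `Nat.card N - l.length` moves is positive here and drops
by one as the past grows by one. The default value 0 at budget zero is never met in a play, whose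
pasts have no repetitions. -/
theorem historyValue_eq (G : MPG N) {l : List N} (a : N) (h : l.length < Nat.card N) :
    G.historyValue l a = match G.owner a with
      | .zero => sInf (G.moveValue G.historyValue (l ++ [a]) '' {b | G.Adj a b})
      | .one => sSup (G.moveValue G.historyValue (l ++ [a]) '' {b | G.Adj a b}) := by
  obtain ⟨n, hn⟩ : ∃ n, Nat.card N - l.length = n + 1 := ⟨Nat.card N - l.length - 1, by omega⟩
  have h' : (l ++ [a]).length + n = Nat.card N := by
    simp only [List.length_append, List.length_singleton]
    omega
  rw [← G.moveValue_backward h', historyValue, hn, backward]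

namespace IsPlay

variable {G : MPG N} {s : N} {ρ : ℕ → N} {i j : ℕ}

theorem moveValue_of_lt (h : G.IsPlay s ρ i j) (f : List N → N → ℝ) {t : ℕ} (ht : t < j) :
    G.moveValue f ((List.range t).map ρ) (ρ t) = f ((List.range t).map ρ) (ρ t) := by
  refine if_neg ?_
  simp only [List.mem_map, List.mem_range, not_exists, not_and]
  exact fun a ha => h.fresh a t ha ht

theorem moveValue_end (h : G.IsPlay s ρ i j) (f : List N → N → ℝ) :
    G.moveValue f ((List.range j).map ρ) (ρ j) = G.payoff ρ i j := by
  classical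
  have hmem : ρ j ∈ (List.range j).map ρ :=
    List.mem_map.2 ⟨i, List.mem_range.2 h.lt, h.closes⟩
  have hlen : ((List.range j).map ρ).length = j := by simp
  -- A first occurrence at any other index would be a repetition before time `j`.
  have hidx : ((List.range j).map ρ).idxOf (ρ j) = i := by
    have h1 := List.idxOf_lt_length_iff.2 hmem
    have h2 := List.getElem_idxOf h1
    rw [List.getElem_map, List.getElem_range] at h2
    replace h2 := h2.trans h.closes.symm
    rw [hlen] at h1
    by_contra hne
    rcases lt_or_gt_of_ne hne with h' | h'
    · exact h.fresh _ _ h' h.lt h2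
    · exact h.fresh _ _ h' h1 h2.symm
  unfold moveValue
  rw [if_pos hmem]
  have : ((List.range j).map ρ) ++ [ρ j] = (List.range (j + 1)).map ρ := by
    rw [List.range_succ, List.map_append]
    rfl
  have e := G.payoff_congr (ρ := fun t => ((List.range (j + 1)).map ρ).getD t (ρ j)) (ρ' := ρ)
    (i := i) (j := j) fun t _ ht => by
      rw [List.getD_eq_getElem _ _ (by simp; omega), List.getElem_map, List.getElem_range]
  rw [← e, this, hlen]
  convert rfl
  exact hidx.symm

/-- What holds between the values before and after each move holds between the value at the start
and the payoff. -/
theorem rel_payoff (h : G.IsPlay s ρ i j) (r : ℝ → ℝ → Prop) [Std.Refl r] [IsTrans ℝ r]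
    (hr : ∀ t < j, r (G.historyValue ((List.range t).map ρ) (ρ t))
      (G.moveValue G.historyValue ((List.range (t + 1)).map ρ) (ρ (t + 1)))) :
    r (G.historyValue [] s) (G.payoff ρ i j) := by
  have hj : 0 < j := (Nat.zero_le i).trans_lt h.lt
  -- No move before the last one closes a cycle, so up to there `moveValue` is the next
  -- `historyValue`, and the relations chain by transitivity.
  have key : ∀ t < j, r (G.historyValue [] s) (G.historyValue ((List.range t).map ρ) (ρ t)) := by
    intro t
    induction t with
    | zero =>
      intro _
      rw [h.start]
      exact refl _
    | succ t ih =>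
      intro ht
      have := hr t (by omega)
      rw [h.moveValue_of_lt _ ht] at this
      exact _root_.trans (ih (by omega)) this
  obtain ⟨k, rfl⟩ : ∃ k, j = k + 1 := ⟨j - 1, by omega⟩
  have := hr k (by omega)
  rw [h.moveValue_end] at this
  exact _root_.trans (key k (by omega)) this

end IsPlay

variable [Finite N]

theorem exists_moveValue_eq (G : MPG N) (l : List N) (a : N) (h : l.length < Nat.card N) :
    ∃ b, G.Adj a b ∧ G.moveValue G.historyValue (l ++ [a]) b = G.historyValue l a := by
  have hne : (G.moveValue G.historyValue (l ++ [a]) '' {b | G.Adj a b}).Nonempty :=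
    Set.Nonempty.image _ (G.exists_out a)
  have hfin : (G.moveValue G.historyValue (l ++ [a]) '' {b | G.Adj a b}).Finite :=
    (Set.toFinite _).image _
  rw [G.historyValue_eq a h]
  cases G.owner a with
  | zero => exact hne.csInf_mem hfin
  | one => exact hne.csSup_mem hfin

theorem historyValue_le (G : MPG N) {l : List N} {a b : N} (h : l.length < Nat.card N)
    (ha : G.owner a = .zero) (hab : G.Adj a b) :
    G.historyValue l a ≤ G.moveValue G.historyValue (l ++ [a]) b := by
  rw [G.historyValue_eq a h, ha]
  exact csInf_le ((Set.toFinite _).image _).bddBelow ⟨b, hab, rfl⟩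

theorem le_historyValue (G : MPG N) {l : List N} {a b : N} (h : l.length < Nat.card N)
    (ha : G.owner a = .one) (hab : G.Adj a b) :
    G.moveValue G.historyValue (l ++ [a]) b ≤ G.historyValue l a := by
  rw [G.historyValue_eq a h, ha]
  exact le_csSup ((Set.toFinite _).image _).bddAbove ⟨b, hab, rfl⟩

/-- The extremum over the finitely many moves is attained. For longer pasts, which no play produces,
any legal move is taken. -/
theorem exists_optimal_strategy (G : MPG N) (p : Player) :
    ∃ σ : G.Strategy p, ∀ l a, l.length < Nat.card N →
      G.moveValue G.historyValue (l ++ [a]) (σ.move l a) = G.historyValue l a := by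
  have : ∀ l a, ∃ b, G.Adj a b ∧ (l.length < Nat.card N →
      G.moveValue G.historyValue (l ++ [a]) b = G.historyValue l a) := by
    intro l a
    by_cases h : l.length < Nat.card N
    · obtain ⟨b, hb, e⟩ := G.exists_moveValue_eq l a h
      exact ⟨b, hb, fun _ => e⟩
    · obtain ⟨b, hb⟩ := G.exists_out a
      exact ⟨b, hb, fun h' => absurd h' h⟩
  choose f hf hv using this
  exact ⟨⟨f, fun l a _ => hf l a⟩, hv⟩

namespace IsPlay

variable {G : MPG N} {s : N} {ρ : ℕ → N} {i j : ℕ}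

theorem lt_card (h : G.IsPlay s ρ i j) {t : ℕ} (ht : t < j) :
    ((List.range t).map ρ).length < Nat.card N := by
  have hinj : Function.Injective (fun t : Fin j => ρ t) := by
    intro a b hab
    by_contra hne
    rcases lt_or_gt_of_ne hne with h' | h'
    · exact h.fresh a b h' b.2 hab
    · exact h.fresh b a h' a.2 hab.symm
  have := Nat.card_le_card_of_injective _ hinj
  rw [Nat.card_fin] at this
  rw [List.length_map, List.length_range]
  omega

end IsPlay

/-- An optimal move keeps the value constant, and a move of the opponent can change it only to the
opponent's disadvantage, so the value is monotone along the play up to the payoff. -/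
theorem isValue_historyValue (G : MPG N) (s : N) : G.IsValue s (G.historyValue [] s) := by
  have hsucc : ∀ (ρ : ℕ → N) t,
      (List.range (t + 1)).map ρ = (List.range t).map ρ ++ [ρ t] := fun ρ t => by
    rw [List.range_succ, List.map_append]
    rfl
  constructor
  · obtain ⟨σ, hσ⟩ := G.exists_optimal_strategy .zero
    refine ⟨σ, fun ρ i j hρ hfol => hρ.rel_payoff (· ≥ ·) fun t ht => ?_⟩
    rw [hsucc]
    cases ho : G.owner (ρ t) with
    | zero =>
      rw [hfol t ht ho, hσ _ _ (hρ.lt_card ht)]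
    | one => exact G.le_historyValue (hρ.lt_card ht) ho (hρ.adj t ht)
  · obtain ⟨σ, hσ⟩ := G.exists_optimal_strategy .one
    refine ⟨σ, fun ρ i j hρ hfol => hρ.rel_payoff (· ≤ ·) fun t ht => ?_⟩
    rw [hsucc]
    cases ho : G.owner (ρ t) with
    | zero => exact G.historyValue_le (hρ.lt_card ht) ho (hρ.adj t ht)
    | one =>
      rw [hfol t ht ho, hσ _ _ (hρ.lt_card ht)]

theorem mem_thresholdSet_zero_iff (G : MPG N) (s : N) :
    s ∈ G.thresholdSet 0 ↔ G.WinningStart .one s := by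
  constructor
  · rintro ⟨r, ⟨-, σ, hσ⟩, hr⟩
    exact ⟨σ, fun ρ i j h hf => not_lt.2 (hr.trans (hσ ρ i j h hf))⟩
  · rintro ⟨τ, hτ⟩
    obtain ⟨σ, hσ⟩ := (G.isValue_historyValue s).1
    -- The winning strategy is played against an optimal one of Player 0: the payoff is nonnegative
    -- and at most the value.
    obtain ⟨ρ, i, j, h, h0, h1⟩ := exists_isPlay s σ τ
    exact ⟨_, G.isValue_historyValue s, (not_lt.1 (hτ ρ i j h h1)).trans (hσ ρ i j h h0)⟩

theorem thresholdSet_zero_eq_univ_iff (G : MPG N) :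
    G.thresholdSet 0 = Set.univ ↔ ∀ a, G.WinningStart .one a := by
  simp only [Set.eq_univ_iff_forall, mem_thresholdSet_zero_iff]

end Determinacy

end MPG

/-! ### Feasible schedulings as potentials of the claw game -/

namespace HyperarcFamily

variable {V : Type u} {ι : Type v}

/-- `s(t_A) ≥ min_{h ∈ H_A} (s(h) - w_A(h))` for all hyperarcs. -/
def Feasible (F : HyperarcFamily V ι) (s : V → ℝ) : Prop :=
  ∀ A, (F.heads A).inf' (F.heads_nonempty A) (fun h => s h - F.weight A h) ≤ s (F.tail A)

/-- A potential restricts to a scheduling on `V`. A scheduling extends by giving each hyperarc node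
its minimum: some head attains it, and feasibility is the inequality on the arc from the tail. -/
theorem exists_isPotential_clawGame_iff (F : HyperarcFamily V ι) (hF : ∀ x, ∃ A, F.tail A = x) :
    (∃ p, (F.clawGame hF).IsPotential p) ↔ ∃ s, F.Feasible s := by
  constructor
  · rintro ⟨p, hp⟩
    refine ⟨fun x => p (.inl x), fun A => ?_⟩
    obtain ⟨b, hb, hle⟩ := hp.one (.inr A) rfl
    cases b with
    | inr B => exact hb.elim
    | inl h =>
      have h1 : p (.inl h) ≤ p (.inr A) + F.weight A h := hle
      have h2 : p (.inr A) ≤ p (.inl (F.tail A)) + 0 := hp.zero (.inl (F.tail A)) (.inr A) rfl rfl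
      refine (Finset.inf'_le (fun h => p (.inl h) - F.weight A h) hb).trans ?_
      linarith
  · rintro ⟨s, hs⟩
    refine ⟨Sum.elim s fun A =>
      (F.heads A).inf' (F.heads_nonempty A) (fun h => s h - F.weight A h), ?_, ?_⟩
    · rintro (x | A) (y | B) ho hadj
      · exact hadj.elim
      · obtain rfl : F.tail B = x := hadj
        have : _ ≤ s (F.tail B) + 0 := (hs B).trans_eq (add_zero _).symm
        exact this
      · cases ho
      · cases ho
    · rintro (x | A) ho
      · cases ho
      · obtain ⟨h, hh, e⟩ := Finset.exists_mem_eq_inf' (F.heads_nonempty A)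
          (fun h => s h - F.weight A h)
        refine ⟨.inl h, hh, ?_⟩
        simp only [Sum.elim_inl, Sum.elim_inr, e]
        change s h ≤ s h - F.weight A h + F.weight A h
        linarith

theorem isLocalReplacement_clawGame (F : HyperarcFamily V ι) (hF : ∀ x, ∃ A, F.tail A = x) :
    (F.clawGame hF).IsLocalReplacement F claw := by
  refine ⟨fun _ => rfl, fun _ => rfl, ?_⟩
  ext ⟨a, b, r⟩
  simp only [Set.mem_iUnion, Set.mem_image, claw, Set.mem_union, Set.mem_singleton_iff,
    Set.mem_ofPred_eq]
  constructor
  · rintro ⟨hadj, hr⟩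
    rcases a with x | A <;> rcases b with y | B
    · exact hadj.elim
    · obtain rfl : F.tail B = x := hadj
      obtain rfl : r = 0 := hr
      exact ⟨B, _, .inl rfl, rfl⟩
    · obtain rfl : r = F.weight A y := hr
      exact ⟨A, _, .inr ⟨y, hadj, rfl⟩, rfl⟩
    · exact hadj.elim
  · rintro ⟨A, e, rfl | ⟨h, hh, rfl⟩, he⟩
    · cases he
      exact ⟨rfl, rfl⟩
    · cases he
      exact ⟨hh, rfl⟩

theorem exists_feasible_iff_forall_winningStart [Finite V] [Finite ι] (F : HyperarcFamily V ι)
    (hF : ∀ x, ∃ A, F.tail A = x) :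
    (∃ s, F.Feasible s) ↔ ∀ a, (F.clawGame hF).WinningStart .one a := by
  rw [MPG.forall_winningStart_one_iff, exists_isPotential_clawGame_iff]

end HyperarcFamily

namespace HyTN

variable {V : Type u} {ι : Type v}

/-- The hyperarc added at a sink `x` only demands `s x ≥ s x`. -/
theorem feasible_closure_iff (H : HyTN V ι) (s : V → ℝ) : H.closure.Feasible s ↔ H.Feasible s := by
  refine ⟨fun h A => h (.inl A), fun h A => ?_⟩
  rcases A with A | x
  · exact h A
  · refine (Finset.inf'_le _ (Finset.mem_singleton_self x.1)).trans ?_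
    change s x.1 - 0 ≤ s x.1
    rw [sub_zero]

theorem consistent_iff_game [Finite V] [Finite ι] (H : HyTN V ι) (hH : H.SinkFree) :
    H.Consistent ↔ ∀ a, (H.game hH).WinningStart .one a :=
  H.toHyperarcFamily.exists_feasible_iff_forall_winningStart hH

theorem consistent_iff_closedGame [Finite V] [Finite ι] (H : HyTN V ι) :
    H.Consistent ↔ ∀ a, H.closedGame.WinningStart .one a := by
  rw [closedGame, ← HyperarcFamily.exists_feasible_iff_forall_winningStart]
  exact exists_congr fun s => (H.feasible_closure_iff s).symm

end HyTN

/-! ### Invariance of encodings under isomorphism of games -/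

/-- The code of a game does not depend on what its nodes are. -/
theorem MPG.IsCode.of_equiv {N : Type u} {N' : Type v} {G : MPG N} {G' : MPG N'} (e : N' ≃ N)
    (howner : ∀ a, G.owner (e a) = G'.owner a) (hadj : ∀ a b, G.Adj (e a) (e b) ↔ G'.Adj a b)
    (hweight : ∀ a b, G.weight (e a) (e b) = G'.weight a b) {T : ℚ} {y : List Letter}
    (h : G.IsCode T y) : G'.IsCode T y := by
  obtain ⟨P, rfl⟩ := h
  refine ⟨{
    name := fun a => P.name (e a)
    name_injective := P.name_injective.comp e.injective
    nodes := P.nodes.map e.symm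
    nodes_nodup := P.nodes_nodup.map e.symm.injective
    mem_nodes := fun a => List.mem_map.2 ⟨e a, P.mem_nodes _, e.symm_apply_apply a⟩
    out := fun a => (P.out (e a)).map e.symm
    out_nodup := fun a => (P.out_nodup _).map e.symm.injective
    mem_out := fun a b => by
      rw [← hadj, ← P.mem_out, ← e.symm_apply_apply b, List.mem_map_of_injective e.symm.injective,
        e.symm_apply_apply]
    rat := fun a b => P.rat (e a) (e b)
    rat_eq := fun a b hab => by rw [P.rat_eq _ _ ((hadj a b).2 hab), hweight] }, ?_⟩
  simp [MPG.Presentation.code, List.flatMap_map, ← howner]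

/-- Without sinks the two games differ only by an empty summand in the node type, so the same output
word serves both. -/
theorem HyTN.SinkFree.isCode_game {V : Type u} {ι : Type v} {H : HyTN V ι} (hH : H.SinkFree)
    {T : ℚ} {y : List Letter} (h : H.closedGame.IsCode T y) : (H.game hH).IsCode T y := by
  have : IsEmpty {x : V // H.IsSink x} := ⟨fun ⟨x, hx⟩ => (hH x).elim fun A hA => hx A hA⟩
  refine h.of_equiv (Equiv.sumCongr (Equiv.refl V) (Equiv.sumEmpty ι _).symm) ?_ ?_ ?_
  · rintro (x | A) <;> rfl
  · rintro (x | A) (y | B) <;> exact Iff.rfl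
  · rintro (x | A) (y | B) <;> rfl

/-! ### The machine and its runs -/

namespace ClawReduction

/-- The states of the machine. A first traversal of the input writes the nodes of Player 0 and the
new nodes of the sinks, a second one the nodes of the hyperarcs. -/
inductive State
  | start
  /-- First traversal: look for the next node or hyperarc. -/
  | skip
  /-- First traversal: the name of a node is being copied, for the `k`-th time. -/
  | name (k : Fin 4)
  /-- First traversal: go back to the beginning of the name of a node. -/
  | back (k : Fin 4)
  /-- First traversal: the name of a hyperarc is being copied. -/
  | hyperName
  | rewind
  /-- Second traversal: the name of a node is being skipped. -/
  | skipName
  /-- Second traversal: the hyperarcs with their heads and weights are being copied. -/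
  | copy

instance : Finite State :=
  Finite.of_injective (β := Fin 8 × Fin 4)
    (fun
      | .start => (0, 0)
      | .skip => (1, 0)
      | .name k => (2, k)
      | .back k => (3, k)
      | .hyperName => (4, 0)
      | .rewind => (5, 0)
      | .skipName => (6, 0)
      | .copy => (7, 0))
    (by rintro (_ | _) (_ | _) h <;> simp_all)

/-- What is done at the end of the `k`-th copy of the name of a node. -/
def nameEnd : Fin 4 → InSym Letter → State × HeadMove × List Letter
  | 0, .sym .hyper => (.skip, .stay, [])
  | 0, _ => (.back 0, .left, [.arc, .bit true, .bit true])
  | 1, _ => (.back 1, .left, .weight :: ratCode 0 ++ [.white, .bit true, .bit true])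
  | 2, _ => (.back 2, .left, [.arc, .bit false])
  | 3, _ => (.skip, .stay, .weight :: ratCode 0)

/-- What the second traversal writes for a letter of the description of a hyperarc. -/
def copyLetter : Letter → List Letter
  | .hyper => [.white, .bit true, .bit false]
  | .head => [.arc, .bit false]
  | a => [a]

def act : State → InSym Letter → Option (State × HeadMove × List Letter)
  | .start, _ => some (.skip, .right, .threshold :: ratCode 0)
  | .skip, .sym .node => some (.name 0, .right, [.black, .bit false])
  | .skip, .sym .hyper => some (.hyperName, .right, [.arc, .bit true, .bit false])
  | .skip, .sym _ => some (.skip, .right, [])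
  | .skip, _ => some (.rewind, .left, [])
  | .name k, .sym (.bit b) => some (.name k, .right, [.bit b])
  | .name k, a => some (nameEnd k a)
  | .back k, .sym (.bit _) => some (.back k, .left, [])
  | .back k, _ => some (.name (k + 1), .right, [])
  | .hyperName, .sym (.bit b) => some (.hyperName, .right, [.bit b])
  | .hyperName, _ => some (.skip, .stay, .weight :: ratCode 0)
  | .rewind, .left => some (.copy, .right, [])
  | .rewind, _ => some (.rewind, .left, [])
  | .skipName, .sym (.bit _) => some (.skipName, .right, [])
  | .skipName, _ => some (.copy, .stay, [])
  | .copy, .sym .node => some (.skipName, .right, [])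
  | .copy, .sym a => some (.copy, .right, copyLetter a)
  | .copy, _ => none

/-- The machine that computes the reduction. It does not use its work tape. -/
def machine : Transducer Letter Letter where
  Q := State
  Γ := Unit
  finite_Q := inferInstance
  finite_Γ := inferInstance
  blank := ()
  start := .start
  step q a _ := (act q a).map fun r => (r.1, r.2.1, (), .stay, r.2.2)

/-- The configuration with the input head in the cell `k`. -/
def conf (q : State) (k : ℕ) (o : List Letter) : machine.Cfg := ⟨q, k, fun _ => (), 0, o⟩

theorem next_conf (x : List Letter) (q : State) (k : ℕ) (o : List Letter) :
    machine.next x (conf q k o) = (act q (Transducer.readIn x k)).map fun r =>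
      conf r.1 (Transducer.moveIn (x.length + 1) r.2.1 k) (o ++ r.2.2) := by
  unfold Transducer.next
  simp only [machine, conf, Option.map_map]
  rfl

/-- On the input `x`, the machine comes from `c` to `d` in at most `n` steps. -/
def Reach (x : List Letter) (n : ℕ) (c d : machine.Cfg) : Prop :=
  ∃ t ≤ n, (fun o : Option machine.Cfg => o.bind (machine.next x))^[t] (some c) = some d

theorem Reach.refl (x : List Letter) (c : machine.Cfg) : Reach x 0 c c := ⟨0, le_rfl, rfl⟩

theorem Reach.trans {x : List Letter} {m n : ℕ} {c d e : machine.Cfg} (h : Reach x m c d)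
    (h' : Reach x n d e) : Reach x (m + n) c e := by
  obtain ⟨s, hs, e1⟩ := h
  obtain ⟨t, ht, e2⟩ := h'
  refine ⟨t + s, by omega, ?_⟩
  rw [Function.iterate_add_apply, e1, e2]

theorem Reach.mono {x : List Letter} {m n : ℕ} {c d : machine.Cfg} (h : Reach x m c d)
    (hmn : m ≤ n) : Reach x n c d :=
  let ⟨t, ht, e⟩ := h
  ⟨t, ht.trans hmn, e⟩

theorem Reach.single {x : List Letter} {q q' : State} {k : ℕ} {o w : List Letter} {m : HeadMove}
    (h : act q (Transducer.readIn x k) = some (q', m, w)) :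
    Reach x 1 (conf q k o) (conf q' (Transducer.moveIn (x.length + 1) m k) (o ++ w)) := by
  refine ⟨1, le_rfl, ?_⟩
  rw [Function.iterate_one, Option.bind_some, next_conf, h]
  rfl

theorem run_eq_iterate (x : List Letter) (t : ℕ) :
    machine.run x t =
      (fun o : Option machine.Cfg => o.bind (machine.next x))^[t] (some (conf .start 0 [])) := by
  induction t with
  | zero => rfl
  | succ t ih => rw [Function.iterate_succ_apply', ← ih, Transducer.run]

theorem workPos_eq_zero_of_run (x : List Letter) (t : ℕ) {d : machine.Cfg}
    (h : machine.run x t = some d) : d.workPos = 0 := by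
  induction t generalizing d with
  | zero =>
    cases h
    rfl
  | succ t ih =>
    obtain ⟨c, hc, hd⟩ := Option.bind_eq_some_iff.1 h
    obtain ⟨r, hr, rfl⟩ := Option.map_eq_some_iff.1 hd
    obtain ⟨r', -, rfl⟩ := Option.map_eq_some_iff.1 hr
    have := ih hc
    exact this

/-- Only the time has to be counted: the work head stays in cell 0, and the logarithm of `x.length +
2` is at least 1. -/
theorem computesWithin_of_reach {x y : List Letter} {C n k : ℕ} {q : State} (hC : 0 < C)
    (hn : n ≤ C * (x.length + 1)) (h : Reach x n (conf .start 0 []) (conf q k y))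
    (hq : act q (Transducer.readIn x k) = none) : machine.ComputesWithin C x y := by
  obtain ⟨t, ht, e⟩ := h
  refine ⟨t, ht.trans hn, _, (run_eq_iterate x t).trans e, by rw [next_conf, hq]; rfl, rfl,
    fun k _ d hd => ?_⟩
  rw [workPos_eq_zero_of_run x k hd]
  exact Nat.mul_pos hC (Nat.log_pos one_lt_two (by omega))

/-- The symbol read at the beginning of the rest `v` of the input. -/
def firstSym : List Letter → InSym Letter
  | [] => .right
  | a :: _ => .sym a

/-- Cell 0 holds the left marker, which shifts all positions by one. -/
theorem readIn_append (u v : List Letter) :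
    Transducer.readIn (u ++ v) (u.length + 1) = firstSym v := by
  cases v <;> simp [Transducer.readIn, firstSym]

theorem readIn_last (u v : List Letter) (a : Letter) :
    Transducer.readIn (u ++ a :: v) (u.length + 1) = .sym a :=
  readIn_append u (a :: v)

section Steps

variable {q q' : State} {w : List Letter}

theorem reach_right {a : Letter} (h : act q (.sym a) = some (q', .right, w))
    (u v o : List Letter) :
    Reach (u ++ a :: v) 1 (conf q (u.length + 1) o) (conf q' (u.length + 2) (o ++ w)) := by
  rw [← readIn_last u v a] at h
  have := Reach.single (o := o) h
  -- The head is on a letter, not on the right marker, so the cap in `moveIn` has no effect.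
  rwa [Transducer.moveIn, min_eq_left] at this
  simp

theorem reach_left {v : List Letter} (h : act q (firstSym v) = some (q', .left, w))
    (u o : List Letter) :
    Reach (u ++ v) 1 (conf q (u.length + 1) o) (conf q' u.length (o ++ w)) := by
  rw [← readIn_append u v] at h
  exact Reach.single (o := o) h

theorem reach_stay {v : List Letter} (h : act q (firstSym v) = some (q', .stay, w))
    (u o : List Letter) :
    Reach (u ++ v) 1 (conf q (u.length + 1) o) (conf q' (u.length + 1) (o ++ w)) := by
  rw [← readIn_append u v] at h
  exact Reach.single (o := o) h

/-- Covers all rightward loops of the machine: copying (`f a = [a]`), skipping (`f a = []`) and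
translating (`copyLetter`). -/
theorem reach_sweep {f : Letter → List Letter}
    (h : ∀ a ∈ w, act q (.sym a) = some (q, .right, f a)) (u v o : List Letter) :
    Reach (u ++ (w ++ v)) w.length (conf q (u.length + 1) o)
      (conf q ((u ++ w).length + 1) (o ++ w.flatMap f)) := by
  induction w generalizing u o with
  | nil => simpa using Reach.refl _ _
  | cons a w ih =>
    have h1 := reach_right (h a List.mem_cons_self) u (w ++ v) o
    have h2 := ih (fun b hb => h b (List.mem_cons_of_mem a hb)) (u ++ [a]) (o ++ f a)
    have := h1.trans (by simpa [Nat.add_assoc] using h2)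
    rw [Nat.add_comm 1] at this
    simpa [Nat.add_assoc] using this

/-- The head starts on the last letter of `w` and stops on the cell just before `w`, which is the
left marker if `u` is empty. -/
theorem reach_sweep_left (h : ∀ a ∈ w, act q (.sym a) = some (q, .left, [])) (u v o : List Letter) :
    Reach (u ++ (w ++ v)) w.length (conf q (u ++ w).length o) (conf q u.length o) := by
  induction w generalizing u with
  | nil => simpa using Reach.refl _ _
  | cons a w ih =>
    have h1 := ih (fun b hb => h b (List.mem_cons_of_mem a hb)) (u ++ [a])
    have h2 := reach_left (v := a :: (w ++ v)) (h a List.mem_cons_self) u o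
    simpa [Nat.add_assoc, Nat.add_comm 1] using
      Reach.trans (by simpa [Nat.add_assoc, Nat.add_comm 1] using h1) h2

/-- Processing a concatenation piece by piece, where each piece may presuppose something about the
rest of the input. -/
theorem reach_flatMap {α : Type*} {K : ℕ} {c e : α → List Letter} {R : List Letter → Prop}
    (hR : ∀ a v, R v → R (c a ++ v))
    (h : ∀ a u v o, R v → Reach (u ++ (c a ++ v)) (K * (c a).length) (conf q (u.length + 1) o)
      (conf q ((u ++ c a).length + 1) (o ++ e a)))
    (l : List α) (u v o : List Letter) (hv : R v) :
    Reach (u ++ (l.flatMap c ++ v)) (K * (l.flatMap c).length) (conf q (u.length + 1) o)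
      (conf q ((u ++ l.flatMap c).length + 1) (o ++ l.flatMap e)) := by
  induction l generalizing u o with
  | nil => simpa using Reach.refl _ _
  | cons a l ih =>
    have hv' : R (l.flatMap c ++ v) := by
      clear ih
      induction l with
      | nil => exact hv
      | cons b l ih =>
        rw [List.flatMap_cons, List.append_assoc]
        exact hR b _ ih
    have h1 := h a u _ o hv'
    have h2 := ih (u ++ c a) (o ++ e a)
    simp only [List.flatMap_cons, List.append_assoc, List.length_append, Nat.mul_add] at h1 h2 ⊢
    exact h1.trans (by simpa only [Nat.add_assoc] using h2)

end Steps

end ClawReduction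

/-! ### The two traversals, piece by piece -/

namespace ClawReduction

/-- Writing a name, in any of the states that do so. -/
theorem reach_bits {q : State} (h : ∀ b, act q (.sym (.bit b)) = some (q, .right, [.bit b]))
    (n : List Bool) (u v o : List Letter) :
    Reach (u ++ (bitsCode n ++ v)) n.length (conf q (u.length + 1) o)
      (conf q ((u ++ bitsCode n).length + 1) (o ++ bitsCode n)) := by
  have := reach_sweep (q := q) (w := bitsCode n) (f := fun a => [a]) (by
    intro a ha
    obtain ⟨b, -, rfl⟩ := List.mem_map.1 ha
    exact h b) u v o
  simpa [bitsCode] using this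

/-- Going back to the beginning of the name of a node, to copy it once more. -/
theorem reach_copy_again {k : Fin 4} {v w : List Letter}
    (h : act (.name k) (firstSym v) = some (.back k, .left, w)) (n : List Bool)
    (u o : List Letter) :
    Reach (u ++ .node :: (bitsCode n ++ v)) (2 * n.length + 2)
      (conf (.name k) (u.length + 2) o)
      (conf (.name (k + 1)) (u.length + 2) (o ++ (bitsCode n ++ w))) := by
  have h1 := reach_bits (q := .name k) (fun _ => rfl) n (u ++ [.node]) v o
  have h2 := reach_left h (u ++ .node :: bitsCode n) (o ++ bitsCode n)
  have h3 := reach_sweep_left (q := .back k) (w := bitsCode n) (by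
    intro a ha
    obtain ⟨b, -, rfl⟩ := List.mem_map.1 ha
    rfl) (u ++ [.node]) v (o ++ bitsCode n ++ w)
  have h4 := reach_right (q := .back k) (a := .node) rfl u (bitsCode n ++ v) (o ++ bitsCode n ++ w)
  simp only [List.append_assoc, List.cons_append, List.nil_append, List.append_nil,
    List.length_append, List.length_cons, List.length_nil, Nat.add_assoc, Nat.add_comm 1]
    at h1 h2 h3 h4
  refine (((h1.trans h2).trans h3).trans h4).mono ?_
  simp only [bitsCode, List.length_map]
  omega

/-- The first traversal at the name of a node that is followed by a hyperarc. -/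
theorem reach_name_hyper (n : List Bool) (u v o : List Letter) :
    Reach (u ++ .node :: (bitsCode n ++ .hyper :: v)) (n.length + 2)
      (conf .skip (u.length + 1) o)
      (conf .skip ((u ++ .node :: bitsCode n).length + 1)
        (o ++ .black :: .bit false :: bitsCode n)) := by
  have h1 := reach_right (q := .skip) (a := .node) rfl u (bitsCode n ++ .hyper :: v) o
  have h2 := reach_bits (q := .name 0) (fun _ => rfl) n (u ++ [.node]) (.hyper :: v)
    (o ++ [.black, .bit false])
  have h3 := reach_stay (q := .name 0) (v := .hyper :: v) rfl (u ++ .node :: bitsCode n)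
    (o ++ [.black, .bit false] ++ bitsCode n)
  simp only [List.append_assoc, List.cons_append, List.nil_append, List.append_nil,
    List.length_append, List.length_cons, List.length_nil, Nat.add_assoc, Nat.add_comm 1]
    at h1 h2 h3 ⊢
  refine ((h1.trans h2).trans h3).mono ?_
  omega

/-- What is written for a sink after its own name: the arc to its new node, and that node. -/
def sinkCode (n : List Bool) : List Letter :=
  [.arc, .bit true, .bit true] ++ bitsCode n ++ .weight :: ratCode 0 ++
    ([.white, .bit true, .bit true] ++ bitsCode n ++ ([.arc, .bit false] ++ bitsCode n ++
      .weight :: ratCode 0))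

/-- The rest of the input is empty or begins with a node. -/
def AtNode (v : List Letter) : Prop := firstSym v = .right ∨ firstSym v = .sym .node

/-- The first traversal at a sink. -/
theorem reach_sink (n : List Bool) (u v o : List Letter) (hv : AtNode v) :
    Reach (u ++ .node :: (bitsCode n ++ v)) (7 * n.length + 8)
      (conf .skip (u.length + 1) o)
      (conf .skip ((u ++ .node :: bitsCode n).length + 1)
        (o ++ .black :: .bit false :: (bitsCode n ++ sinkCode n))) := by
  have h0 := reach_right (q := .skip) (a := .node) rfl u (bitsCode n ++ v) o
  -- No hyperarc follows, so the node is a sink and its name is written four times. Four passes to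
  -- the right and three back give the `7 * n.length` in the time bound.
  have h1 := reach_copy_again (k := 0) (v := v) (w := [.arc, .bit true, .bit true])
    (by rcases hv with h | h <;> rw [h] <;> rfl) n u
  have h2 := reach_copy_again (k := 1) (v := v)
    (w := .weight :: ratCode 0 ++ [.white, .bit true, .bit true])
    (by rcases hv with h | h <;> rw [h] <;> rfl) n u
  have h3 := reach_copy_again (k := 2) (v := v) (w := [.arc, .bit false])
    (by rcases hv with h | h <;> rw [h] <;> rfl) n u
  have h4 := reach_bits (q := .name 3) (fun _ => rfl) n (u ++ [.node]) v
  have h5 := reach_stay (q := .name 3) (q' := .skip) (v := v) (w := .weight :: ratCode 0)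
    (by rcases hv with h | h <;> rw [h] <;> rfl) (u ++ .node :: bitsCode n)
  simp only [List.append_assoc, List.cons_append, List.nil_append,
    List.length_append, List.length_cons, List.length_nil, Nat.add_assoc, Nat.add_comm 1]
    at h0 h1 h2 h3 h4 h5
  have := ((((h0.trans (h1 _)).trans (h2 _)).trans (h3 _)).trans (h4 _)).trans (h5 _)
  simp only [sinkCode, List.append_assoc, List.cons_append, List.nil_append, List.length_append,
    List.length_cons, Nat.add_assoc] at this ⊢
  refine this.mono ?_
  omega

/-- The first traversal at a hyperarc with the name `n` and the description `r`. -/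
theorem reach_hyper (n : List Bool) {r : List Letter} (hr : ∃ r', r = .head :: r')
    (hr' : ∀ a ∈ r, a ≠ .node ∧ a ≠ .hyper) (u v o : List Letter) :
    Reach (u ++ .hyper :: (bitsCode n ++ (r ++ v))) (8 * (1 + n.length + r.length))
      (conf .skip (u.length + 1) o)
      (conf .skip ((u ++ .hyper :: (bitsCode n ++ r)).length + 1)
        (o ++ (.arc :: .bit true :: .bit false :: (bitsCode n ++ .weight :: ratCode 0)))) := by
  have h1 := reach_right (q := .skip) (a := .hyper) rfl u (bitsCode n ++ (r ++ v)) o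
  have h2 := reach_bits (q := .hyperName) (fun _ => rfl) n (u ++ [.hyper]) (r ++ v)
  have h3 := reach_stay (q := .hyperName) (v := r ++ v) (q' := .skip) (w := .weight :: ratCode 0)
    -- The letter `head` marks the end of the name of the hyperarc.
    (by obtain ⟨r', rfl⟩ := hr; rfl) (u ++ .hyper :: bitsCode n)
  have h4 := reach_sweep (q := .skip) (w := r) (f := fun _ => []) (by
    intro a ha
    have := hr' a ha
    cases a <;> first | rfl | exact absurd rfl this.1 | exact absurd rfl this.2)
    (u ++ .hyper :: bitsCode n) v
  simp only [List.append_assoc, List.cons_append, List.nil_append, List.append_nil,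
    List.length_append, List.length_cons, List.length_nil, Nat.add_assoc, Nat.add_comm 1,
    List.flatMap_eq_nil_iff.2 (fun _ _ => rfl)]
    at h1 h2 h3 h4
  have := ((h1.trans (h2 _)).trans (h3 _)).trans (h4 _)
  simp only [List.append_assoc, List.cons_append, List.nil_append, List.length_append,
    List.length_cons, Nat.add_assoc, Nat.add_comm 1] at this ⊢
  refine this.mono ?_
  omega

/-- The second traversal at the name of a node. -/
theorem reach_skipName (n : List Bool) {v : List Letter}
    (hv : firstSym v = .right ∨ firstSym v = .sym .node ∨ firstSym v = .sym .hyper)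
    (u o : List Letter) :
    Reach (u ++ .node :: (bitsCode n ++ v)) (n.length + 2)
      (conf .copy (u.length + 1) o)
      (conf .copy ((u ++ .node :: bitsCode n).length + 1) o) := by
  have h1 := reach_right (q := .copy) (a := .node) rfl u (bitsCode n ++ v) o
  have h2 := reach_sweep (q := .skipName) (w := bitsCode n) (f := fun _ => []) (by
    intro a ha
    obtain ⟨b, -, rfl⟩ := List.mem_map.1 ha
    rfl) (u ++ [.node]) v
  have h3 := reach_stay (q := .skipName) (q' := .copy) (w := []) (v := v)
    (by rcases hv with h | h | h <;> rw [h] <;> rfl) (u ++ .node :: bitsCode n)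
  simp only [List.append_assoc, List.cons_append, List.nil_append, List.append_nil,
    List.length_append, List.length_cons, List.length_nil, Nat.add_assoc, Nat.add_comm 1,
    List.flatMap_eq_nil_iff.2 (fun _ _ => rfl)]
    at h1 h2 h3 ⊢
  refine ((h1.trans (h2 _)).trans (h3 _)).mono ?_
  simp only [bitsCode, List.length_map]
  omega

/-- From the start to the first traversal. -/
theorem reach_start (x : List Letter) :
    Reach x 1 (conf .start 0 []) (conf .skip 1 (.threshold :: ratCode 0)) := by
  have := Reach.single (x := x) (q := .start) (k := 0) (o := []) (by rfl)
  simpa [Transducer.moveIn] using this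

/-- From the end of the first traversal to the beginning of the second one. -/
theorem reach_rewind (x o : List Letter) :
    Reach x (x.length + 2) (conf .skip (x.length + 1) o) (conf .copy 1 o) := by
  have h1 := reach_left (q := .skip) (v := []) rfl x o
  have h2 := reach_sweep_left (q := .rewind) (w := x) (fun _ _ => rfl) [] [] o
  have h3 := Reach.single (x := x) (q := .rewind) (k := 0) (o := o) (by rfl)
  simp only [List.append_nil, List.nil_append, List.length_nil, Transducer.moveIn,
    Nat.zero_add, min_eq_left (Nat.le_add_left 1 x.length)] at h1 h2 h3
  refine ((h1.trans h2).trans h3).mono ?_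
  omega

variable {V : Type u} {ι : Type v} {H : HyTN V ι} (P : H.Presentation)

/-- The heads of a hyperarc, with their weights. -/
def headsCode (A : ι) : List Letter :=
  (P.headList A).flatMap fun h =>
    Letter.head :: bitsCode (P.nodeName h) ++ Letter.weight :: ratCode (P.rat A h)

def hyperCode (A : ι) : List Letter := Letter.hyper :: bitsCode (P.hyperName A) ++ headsCode P A

def nodeCode (x : V) : List Letter :=
  Letter.node :: bitsCode (P.nodeName x) ++ (P.out x).flatMap (hyperCode P)

theorem code_eq : P.code = P.nodes.flatMap (nodeCode P) := rfl

theorem isSink_iff (x : V) : H.IsSink x ↔ P.out x = [] := by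
  rw [List.eq_nil_iff_forall_not_mem]
  exact forall_congr' fun A => not_congr (P.mem_out x A).symm

theorem exists_headsCode_eq (A : ι) : ∃ r, headsCode P A = .head :: r := by
  obtain ⟨h, hh⟩ := H.heads_nonempty A
  rw [← P.mem_headList] at hh
  unfold headsCode
  cases hl : P.headList A with
  | nil =>
    rw [hl] at hh
    cases hh
  | cons a l => exact ⟨_, rfl⟩

/-- Numbers contain none of the letters that the machine reacts to or translates. -/
theorem mem_ratCode {q : ℚ} {a : Letter} (h : a ∈ ratCode q) :
    a = .neg ∨ a = .slash ∨ ∃ b, a = .bit b := by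
  unfold ratCode bitsCode at h
  split_ifs at h <;> simp only [List.mem_append, List.mem_map, List.mem_singleton,
    List.not_mem_nil, false_or] at h <;> aesop

theorem copyLetter_ratCode (q : ℚ) : (ratCode q).flatMap copyLetter = ratCode q := by
  rw [List.flatMap_congr (g := fun a => [a]), List.flatMap_singleton']
  intro a ha
  rcases mem_ratCode ha with rfl | rfl | ⟨b, rfl⟩ <;> rfl

theorem copyLetter_bitsCode (n : List Bool) : (bitsCode n).flatMap copyLetter = bitsCode n := by
  rw [List.flatMap_congr (g := fun a => [a]), List.flatMap_singleton']
  intro a ha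
  obtain ⟨b, -, rfl⟩ := List.mem_map.1 ha
  rfl

/-- Hence the first traversal skips a whole list of heads without leaving the state `skip`. -/
theorem ne_of_mem_headsCode {A : ι} {a : Letter} (h : a ∈ headsCode P A) :
    a ≠ .node ∧ a ≠ .hyper := by
  obtain ⟨h, -, ha⟩ := List.mem_flatMap.1 h
  simp only [List.cons_append, List.mem_cons, List.mem_append] at ha
  rcases ha with rfl | ha | rfl | ha
  · simp
  · obtain ⟨b, -, rfl⟩ := List.mem_map.1 ha
    simp
  · simp
  · rcases mem_ratCode ha with rfl | rfl | ⟨b, rfl⟩ <;> simp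

/-- What the first traversal writes for a node. -/
def firstOutput (x : V) : List Letter :=
  .black :: .bit false :: (bitsCode (P.nodeName x) ++ (if P.out x = [] then sinkCode (P.nodeName x)
    else (P.out x).flatMap fun A =>
      .arc :: .bit true :: .bit false :: (bitsCode (P.hyperName A) ++ .weight :: ratCode 0)))

/-- What the second traversal writes for a hyperarc. -/
def secondOutput (A : ι) : List Letter :=
  .white :: .bit true :: .bit false :: (bitsCode (P.hyperName A) ++ (P.headList A).flatMap fun h =>
    .arc :: .bit false :: (bitsCode (P.nodeName h) ++ .weight :: ratCode (P.rat A h)))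

theorem hyperCode_flatMap_copyLetter (A : ι) :
    (hyperCode P A).flatMap copyLetter = secondOutput P A := by
  simp [hyperCode, headsCode, secondOutput, List.flatMap_append, List.flatMap_assoc,
    copyLetter_bitsCode, copyLetter_ratCode, copyLetter]

theorem nodeCode_append_atNode (x : V) (v : List Letter) : AtNode (nodeCode P x ++ v) := .inr rfl

theorem reach_first_node (x : V) (u v o : List Letter) (hv : AtNode v) :
    Reach (u ++ (nodeCode P x ++ v)) (8 * (nodeCode P x).length) (conf .skip (u.length + 1) o)
      (conf .skip ((u ++ nodeCode P x).length + 1) (o ++ firstOutput P x)) := by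
  by_cases hx : P.out x = []
  · have := reach_sink (P.nodeName x) u v o hv
    simp only [nodeCode, firstOutput, hx, if_true, List.flatMap_nil, List.append_nil,
      List.cons_append]
    refine this.mono ?_
    simp only [bitsCode, List.length_cons, List.length_map]
    omega
  -- The letter `hyper` directly after the name is how the machine recognizes that the node is not a
  -- sink.
  · obtain ⟨r, hr⟩ : ∃ r, (P.out x).flatMap (hyperCode P) ++ v = .hyper :: r := by
      cases hl : P.out x with
      | nil => exact absurd hl hx
      | cons A l => exact ⟨_, rfl⟩
    have h1 := reach_name_hyper (P.nodeName x) u r o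
    -- A hyperarc can be processed whatever follows it, since its head list is nonempty and delimits
    -- its name.
    have h2 := reach_flatMap (q := .skip) (K := 8) (c := hyperCode P) (R := fun _ => True)
      (e := fun A => .arc :: .bit true :: .bit false ::
        (bitsCode (P.hyperName A) ++ .weight :: ratCode 0))
      (fun _ _ _ => trivial)
      (fun A u v o _ => by
        have := reach_hyper (P.hyperName A) (exists_headsCode_eq P A)
          (fun _ => ne_of_mem_headsCode P) u v o
        simp only [hyperCode, List.append_assoc, List.cons_append] at this ⊢
        refine this.mono ?_
        simp only [bitsCode, List.length_cons, List.length_append, List.length_map]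
        omega)
      (P.out x) (u ++ .node :: bitsCode (P.nodeName x)) v
      (o ++ .black :: .bit false :: bitsCode (P.nodeName x)) trivial
    rw [← hr] at h1
    simp only [nodeCode, firstOutput, if_neg hx, List.append_assoc, List.cons_append] at h1 h2 ⊢
    refine (h1.trans h2).mono ?_
    simp only [bitsCode, List.length_cons, List.length_append, List.length_map]
    omega

theorem reach_second_node (x : V) (u v o : List Letter) (hv : AtNode v) :
    Reach (u ++ (nodeCode P x ++ v)) (2 * (nodeCode P x).length) (conf .copy (u.length + 1) o)
      (conf .copy ((u ++ nodeCode P x).length + 1)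
        (o ++ (P.out x).flatMap (secondOutput P))) := by
  have h1 := reach_skipName (P.nodeName x) (v := (P.out x).flatMap (hyperCode P) ++ v) (by
    cases P.out x with
    | nil => exact hv.imp_right .inl
    | cons A l => exact .inr (.inr rfl)) u o
  -- Only the letter `node` interrupts the state `copy`, so one sweep translates all hyperarcs of
  -- the node.
  have h2 := reach_sweep (q := .copy) (w := (P.out x).flatMap (hyperCode P)) (f := copyLetter) (by
    intro a ha
    obtain ⟨A, -, ha⟩ := List.mem_flatMap.1 ha
    have hne : a ≠ .node := by
      rcases List.mem_append.1 ha with ha | ha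
      · rcases List.mem_cons.1 ha with rfl | ha
        · simp
        · obtain ⟨b, -, rfl⟩ := List.mem_map.1 ha
          simp
      · exact (ne_of_mem_headsCode P ha).1
    cases a <;> first | rfl | exact absurd rfl hne)
    (u ++ .node :: bitsCode (P.nodeName x)) v o
  rw [List.flatMap_assoc, List.flatMap_congr fun A _ => hyperCode_flatMap_copyLetter P A] at h2
  simp only [nodeCode, List.append_assoc, List.cons_append] at h1 h2 ⊢
  refine (h1.trans h2).mono ?_
  simp only [bitsCode, List.length_cons, List.length_append, List.length_map]
  omega

/-- The output of the machine. -/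
def output : List Letter :=
  .threshold :: ratCode 0 ++ (P.nodes.flatMap (firstOutput P) ++
    P.nodes.flatMap fun x => (P.out x).flatMap (secondOutput P))

/-- On an input of length `n`, the start takes 1 step, the first traversal at most `8 * n`, the
rewinding `n + 2` and the second traversal `2 * n`, in all `11 * n + 3`. -/
theorem computesWithin_output : machine.ComputesWithin 11 P.code (output P) := by
  have h1 := reach_flatMap (q := .skip) (R := AtNode) (fun x v _ => nodeCode_append_atNode P x v)
    (reach_first_node P) P.nodes [] [] (.threshold :: ratCode 0) (.inl rfl)
  have h2 := reach_flatMap (q := .copy) (R := AtNode) (fun x v _ => nodeCode_append_atNode P x v)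
    (reach_second_node P) P.nodes [] []
    (.threshold :: ratCode 0 ++ P.nodes.flatMap (firstOutput P)) (.inl rfl)
  rw [← code_eq] at h1 h2
  simp only [List.nil_append, List.append_nil, List.length_nil, Nat.zero_add] at h1 h2
  have := (((reach_start P.code).trans h1).trans (reach_rewind _ _)).trans h2
  rw [List.append_assoc] at this
  refine computesWithin_of_reach (by norm_num) ?_ this ?_
  · omega
  · have := readIn_append P.code []
    rw [List.append_nil] at this
    rw [this]
    rfl

/-! ### The output as a presentation of the game -/

section Game

/-- The names of the nodes of the game. -/
def gameName : V ⊕ (ι ⊕ {x : V // H.IsSink x}) → List Bool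
  | .inl x => false :: P.nodeName x
  | .inr (.inl A) => true :: false :: P.hyperName A
  | .inr (.inr x) => true :: true :: P.nodeName x.1

/-- The prefixes `0`, `10`, `11` form a prefix code, so names of different kinds never collide, even
if a node and a hyperarc of the network share a name. -/
theorem gameName_injective : Function.Injective (gameName P) := by
  rintro (x | A | x) (y | B | y) h <;>
    simp only [gameName, List.cons.injEq, reduceCtorEq, true_and, false_and] at h
  · rw [P.nodeName_injective h]
  · rw [P.hyperName_injective h]
  · rw [Subtype.ext (P.nodeName_injective h)]

open Classical in
/-- The new node of `x`, if `x` is a sink. -/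
noncomputable def sinkNodes (x : V) : List (V ⊕ (ι ⊕ {x : V // H.IsSink x})) :=
  if h : H.IsSink x then [.inr (.inr ⟨x, h⟩)] else []

theorem mem_sinkNodes {x : V} {a : V ⊕ (ι ⊕ {x : V // H.IsSink x})} :
    a ∈ sinkNodes (H := H) x ↔ ∃ h : H.IsSink x, a = .inr (.inr ⟨x, h⟩) := by
  unfold sinkNodes
  split_ifs with h <;> simp [h]

theorem sinkNodes_nodup (x : V) : (sinkNodes (H := H) x).Nodup := by
  unfold sinkNodes
  split_ifs <;> simp

/-- The node of the game that belongs to a hyperarc. -/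
def hyperNode (A : ι) : V ⊕ (ι ⊕ {x : V // H.IsSink x}) := .inr (.inl A)

theorem hyperNode_injective : Function.Injective (hyperNode (H := H)) := fun _ _ h => by
  cases h
  rfl

/-- The order in which the machine lists the nodes of the game. -/
noncomputable def gameNodes : List (V ⊕ (ι ⊕ {x : V // H.IsSink x})) :=
  (P.nodes.flatMap fun x => .inl x :: sinkNodes x) ++
    P.nodes.flatMap fun x => (P.out x).map hyperNode

theorem gameNodes_nodup : (gameNodes P).Nodup := by
  refine List.Nodup.append ?_ ?_ ?_
  · refine List.nodup_flatMap.2 ⟨fun x _ => List.nodup_cons.2 ⟨?_, sinkNodes_nodup x⟩, ?_⟩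
    · rw [mem_sinkNodes]
      rintro ⟨_, h⟩
      cases h
    · refine P.nodes_nodup.imp fun {x y} hxy => ?_
      rintro a ha hb
      rw [List.mem_cons, mem_sinkNodes] at ha hb
      rcases ha with rfl | ⟨_, rfl⟩ <;> rcases hb with h | ⟨_, h⟩ <;> cases h <;> exact hxy rfl
  · refine List.nodup_flatMap.2 ⟨fun x _ => (P.out_nodup x).map hyperNode_injective, ?_⟩
    refine P.nodes_nodup.imp fun {x y} hxy => ?_
    rintro a ha hb
    obtain ⟨A, hA, rfl⟩ := List.mem_map.1 ha
    rw [List.mem_map_of_injective hyperNode_injective] at hb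
    rw [P.mem_out] at hA hb
    exact hxy (hA.symm.trans hb)
  · intro a ha hb
    obtain ⟨x, -, ha⟩ := List.mem_flatMap.1 ha
    obtain ⟨y, -, hb⟩ := List.mem_flatMap.1 hb
    obtain ⟨A, -, rfl⟩ := List.mem_map.1 hb
    rw [List.mem_cons, mem_sinkNodes] at ha
    rcases ha with h | ⟨_, h⟩ <;> cases h

theorem mem_gameNodes (a : V ⊕ (ι ⊕ {x : V // H.IsSink x})) : a ∈ gameNodes P := by
  rw [gameNodes, List.mem_append, List.mem_flatMap, List.mem_flatMap]
  rcases a with x | A | x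
  · exact .inl ⟨x, P.mem_nodes x, List.mem_cons_self⟩
  · exact .inr ⟨H.tail A, P.mem_nodes _, List.mem_map_of_mem ((P.mem_out _ A).2 rfl)⟩
  · exact .inl ⟨x.1, P.mem_nodes _, List.mem_cons_of_mem _ (mem_sinkNodes.2 ⟨x.2, rfl⟩)⟩

/-- The order in which the machine lists the arcs of the game. -/
noncomputable def gameOut : V ⊕ (ι ⊕ {x : V // H.IsSink x}) →
    List (V ⊕ (ι ⊕ {x : V // H.IsSink x}))
  | .inl x => sinkNodes x ++ (P.out x).map hyperNode
  | .inr (.inl A) => (P.headList A).map .inl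
  | .inr (.inr x) => [.inl x.1]

theorem gameOut_nodup (a : V ⊕ (ι ⊕ {x : V // H.IsSink x})) : (gameOut P a).Nodup := by
  rcases a with x | A | x
  · refine (sinkNodes_nodup x).append ((P.out_nodup x).map hyperNode_injective) ?_
    intro a ha hb
    obtain ⟨A, -, rfl⟩ := List.mem_map.1 hb
    obtain ⟨_, h⟩ := mem_sinkNodes.1 ha
    cases h
  · exact (P.headList_nodup A).map Sum.inl_injective
  · exact List.nodup_singleton _

theorem mem_gameOut (a b : V ⊕ (ι ⊕ {x : V // H.IsSink x})) :
    b ∈ gameOut P a ↔ H.closedGame.Adj a b := by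
  rcases a with x | A | x
  · rw [gameOut, List.mem_append, mem_sinkNodes, List.mem_map]
    rcases b with y | B | y
    · constructor
      · rintro (⟨_, h⟩ | ⟨_, _, h⟩) <;> cases h
      · exact False.elim
    · change _ ↔ H.tail B = x
      rw [← P.mem_out]
      constructor
      · rintro (⟨_, h⟩ | ⟨_, h, e⟩)
        · cases h
        · cases e
          exact h
      · exact fun h => .inr ⟨B, h, rfl⟩
    · change _ ↔ y.1 = x
      constructor
      · rintro (⟨_, h⟩ | ⟨_, _, h⟩)
        · cases h
          rfl
        · cases h
      · rintro rfl
        exact .inl ⟨y.2, rfl⟩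
  · rcases b with y | b
    · change _ ↔ y ∈ H.heads A
      rw [gameOut, List.mem_map_of_injective Sum.inl_injective, P.mem_headList]
    · change _ ↔ False
      simp [gameOut]
  · rcases b with y | b
    · change _ ↔ y ∈ ({x.1} : Finset V)
      simp [gameOut]
    · change _ ↔ False
      simp [gameOut]

/-- The weights of the arcs of the game. -/
def gameRat : V ⊕ (ι ⊕ {x : V // H.IsSink x}) → V ⊕ (ι ⊕ {x : V // H.IsSink x}) → ℚ
  | .inr (.inl A), .inl h => P.rat A h
  | _, _ => 0

theorem gameRat_eq (a b : V ⊕ (ι ⊕ {x : V // H.IsSink x})) (hab : H.closedGame.Adj a b) :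
    (gameRat P a b : ℝ) = H.closedGame.weight a b := by
  rcases a with x | A | x <;> rcases b with y | b
  · exact hab.elim
  · exact Rat.cast_zero
  · exact P.rat_eq A y hab
  · exact hab.elim
  · exact Rat.cast_zero
  · exact hab.elim

/-- The presentation of the game that the machine writes. -/
noncomputable def gamePresentation : H.closedGame.Presentation where
  name := gameName P
  name_injective := gameName_injective P
  nodes := gameNodes P
  nodes_nodup := gameNodes_nodup P
  mem_nodes := mem_gameNodes P
  out := gameOut P
  out_nodup := gameOut_nodup P
  mem_out := mem_gameOut P
  rat := gameRat P
  rat_eq := gameRat_eq P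

/-- For each node exactly one of `sinkNodes x` and `P.out x` is empty, which matches the case
distinction in `firstOutput`. -/
theorem gamePresentation_code : (gamePresentation P).code 0 = output P := by
  rw [MPG.Presentation.code, output]
  congr 1
  change (gameNodes P).flatMap _ = _
  rw [gameNodes, List.flatMap_append, List.flatMap_assoc, List.flatMap_assoc]
  congr 1
  · refine List.flatMap_congr fun x _ => ?_
    by_cases hx : H.IsSink x
    · have hx' := (isSink_iff P x).1 hx
      simp [sinkNodes, hx, hx', gamePresentation, gameOut, firstOutput, sinkCode, gameName,
        gameRat, HyTN.closedGame, HyperarcFamily.clawGame, Player.colour, bitsCode]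
    · have hx' := mt (isSink_iff P x).2 hx
      simp [sinkNodes, hx, hx', gamePresentation, gameOut, firstOutput, gameName, hyperNode,
        gameRat, HyTN.closedGame, HyperarcFamily.clawGame, Player.colour, bitsCode,
        List.flatMap_map]
  · refine List.flatMap_congr fun x _ => ?_
    rw [List.flatMap_map]
    refine List.flatMap_congr fun A _ => ?_
    simp [gamePresentation, gameOut, secondOutput, gameName, hyperNode,
      gameRat, HyTN.closedGame, HyperarcFamily.clawGame, Player.colour, bitsCode,
      List.flatMap_map]

end Game

end ClawReduction

/-! ### The reduction theorem -/

theorem mainTheorem3 :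
    ∃ (M : Transducer Letter Letter) (C : ℕ),
      ∀ (V : Type u) (ι : Type v) [Finite V] [Finite ι] (H : HyTN V ι),
        -- one machine computes the reduction, in linear time and logarithmic space
        (∀ x : List Letter, H.IsCode x →
          ∃ y : List Letter, M.ComputesWithin C x y ∧ H.closedGame.IsCode 0 y ∧
            ∀ hH : H.SinkFree, (H.game hH).IsCode 0 y) ∧
        -- local replacement and correctness, for the game `G_H` of a sink-free network
        (∀ hH : H.SinkFree,
          (H.game hH).IsLocalReplacement H.toHyperarcFamily claw ∧
          (H.Consistent ↔ ∀ a, (H.game hH).WinningStart .one a) ∧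
          (H.Consistent ↔ (H.game hH).thresholdSet 0 = Set.univ)) ∧
        -- local replacement and correctness, for an arbitrary network
        (H.closedGame.IsLocalReplacement H.closure claw ∧
          (H.Consistent ↔ ∀ a, H.closedGame.WinningStart .one a) ∧
          (H.Consistent ↔ H.closedGame.thresholdSet 0 = Set.univ)) := by
  refine ⟨ClawReduction.machine, 11, fun V ι _ _ H => ⟨?_, fun hH => ⟨?_, ?_, ?_⟩, ?_, ?_, ?_⟩⟩
  · rintro _ ⟨P, rfl⟩
    have hcode : H.closedGame.IsCode 0 (ClawReduction.output P) :=
      ⟨ClawReduction.gamePresentation P, ClawReduction.gamePresentation_code P⟩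
    exact ⟨_, ClawReduction.computesWithin_output P, hcode, fun hH => hH.isCode_game hcode⟩
  · exact H.toHyperarcFamily.isLocalReplacement_clawGame hH
  · exact H.consistent_iff_game hH
  · rw [MPG.thresholdSet_zero_eq_univ_iff]
    exact H.consistent_iff_game hH
  · exact H.closure.isLocalReplacement_clawGame H.closure_tail
  · exact H.consistent_iff_closedGame
  · rw [MPG.thresholdSet_zero_eq_univ_iff]
    exact H.consistent_iff_closedGame
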